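/- Let $a<b$, $0<\alpha<1$, and let $B$ be a normalization function, i.e. $B>0$ on $[0,1]$ and $B(0)=B(1)=1$. For $w\in H^1(a,b)$ with weak derivative $w'$, let $$({}^{ABC}{}_aD^\alpha w)(t)=\frac{B(\alpha)}{1-\alpha}\int_a^t E_\alpha\Big[-\frac{\alpha}{1-\alpha}(t-s)^\alpha\Big]\,w'(s)\,ds,\qquad E_\alpha(z)=\sum_{k=0}^\infty \frac{z^k}{\Gamma(\alpha k+1)} .$$ Let $f$ be a real function that is smooth ($C^\infty$) on $(a,b)\times\mathbb R$, let $\lambda_1,\lambda_2<0$ and $h_1,h_2$ be real functions of $t$, and let $u\in H^1(a,b)\cap C[a,b]$ be a solution of $$({}^{ABC}{}_aD^\alpha u)(t)=f(t,u(t)),\qquad t\in(a,b).$$ Assume that $$\lambda_2 u(t)+h_2(t)\le f(t,u(t))\le \lambda_1 u(t)+h_1(t)\qquad\text{for all } t\in(a,b).$$ Let $v_1,v_2\in H^1(a,b)\cap C[a,b]$ be solutions of $$({}^{ABC}{}_aD^\alpha v_i)(t)=\lambda_i v_i(t)+h_i(t),\qquad t\in(a,b),\quad i=1,2 .$$ Then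 $v_2(t)\le u(t)\le v_1(t)$ for all $t\in[a,b]$. -/

import Mathlib

open Set MeasureTheory
open scoped ContDiff

/-- The one-parameter Mittag-Leffler function `E_α(z) = ∑_{k ≥ 0} z ^ k / Γ(α k + 1)`
(the series converges absolutely for every real `z` when `α > 0`). -/
noncomputable def mittagLeffler (α z : ℝ) : ℝ :=
  ∑' k : ℕ, z ^ k / Real.Gamma (α * k + 1)

/-- `g` is a weak derivative of `f` on the open interval `(a, b)`: both are locally integrable
there, and `∫ f φ' = - ∫ g φ` for all smooth `φ` with compact support inside `(a, b)`. -/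
def HasWeakDeriv (a b : ℝ) (f g : ℝ → ℝ) : Prop :=
  LocallyIntegrableOn f (Ioo a b) volume ∧ LocallyIntegrableOn g (Ioo a b) volume ∧
    ∀ φ : ℝ → ℝ, ContDiff ℝ ∞ φ → HasCompactSupport φ → tsupport φ ⊆ Ioo a b →
      ∫ x in Ioo a b, f x * deriv φ x = - ∫ x in Ioo a b, g x * φ x

/-- Two weak derivatives of the same function agree almost everywhere on the interval. -/
theorem HasWeakDeriv.ae_eq {a b : ℝ} {f g g' : ℝ → ℝ} (h : HasWeakDeriv a b f g)
    (h' : HasWeakDeriv a b f g') : ∀ᵐ x ∂volume, x ∈ Ioo a b → g x = g' x := by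
  have key := isOpen_Ioo.ae_eq_zero_of_integral_contDiff_smul_eq_zero (U := Ioo a b)
    (h.2.1.sub h'.2.1) (μ := volume) (by
      intro φ hφ hc hs
      have hsub : ∀ k : ℝ → ℝ, LocallyIntegrableOn k (Ioo a b) volume →
          IntegrableOn (fun x => k x * φ x) (Ioo a b) volume := by
        intro k hk
        have h1 : IntegrableOn (fun x => k x * φ x) (tsupport φ) volume :=
          (hk.integrableOn_compact_subset hs hc).mul_continuousOn
            hφ.continuous.continuousOn hc
        exact h1.of_forall_sdiff_eq_zero measurableSet_Ioo (fun x hx => by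
          simp [image_eq_zero_of_notMem_tsupport hx.2])
      have e1 := h.2.2 φ hφ hc hs
      have e2 := h'.2.2 φ hφ hc hs
      have e3 : ∫ x, φ x • (g - g') x = ∫ x in Ioo a b, (g x * φ x - g' x * φ x) := by
        rw [← setIntegral_eq_integral_of_forall_compl_eq_zero (s := Ioo a b)]
        · refine setIntegral_congr_fun measurableSet_Ioo (fun x _ => ?_)
          simp only [Pi.sub_apply, smul_eq_mul]
          ring
        · intro x hx
          have : φ x = 0 := image_eq_zero_of_notMem_tsupport (fun hx' => hx (hs hx'))
          simp [this]
      rw [e3, integral_sub (hsub g h.2.1) (hsub g' h'.2.1)]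
      linarith)
  filter_upwards [key] with x hx hxU
  have := hx hxU
  simpa [sub_eq_zero] using this

/-- `f` belongs to the Sobolev space `H¹(a, b)`: `f` is square integrable on `(a, b)` and has a
square integrable weak derivative there. -/
def MemH1 (a b : ℝ) (f : ℝ → ℝ) : Prop :=
  MemLp f 2 (volume.restrict (Ioo a b)) ∧
    ∃ g : ℝ → ℝ, MemLp g 2 (volume.restrict (Ioo a b)) ∧ HasWeakDeriv a b f g

open Classical in
/-- The weak derivative of `f` on `(a, b)` (a representative, unique up to a null set of `(a, b)`;
the zero function if there is none). -/
noncomputable def weakDeriv (a b : ℝ) (f : ℝ → ℝ) : ℝ → ℝ :=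
  if h : ∃ g, HasWeakDeriv a b f g then h.choose else 0

/-- The left Caputo fractional derivative of order `α` with Mittag-Leffler non-singular kernel,
based at `a`, at the point `t ∈ [a, b]`, of a function `f ∈ H¹(a, b)`:
`B(α) / (1 - α) * ∫_a^t E_α[-(α / (1 - α)) (t - s) ^ α] f'(s) ds`. -/
noncomputable def abcDeriv (B : ℝ → ℝ) (α a b : ℝ) (f : ℝ → ℝ) (t : ℝ) : ℝ :=
  B α / (1 - α) *
    ∫ s in a..t, mittagLeffler α (-(α / (1 - α)) * (t - s) ^ α) * weakDeriv a b f s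

open Filter Topology

/-! Both inequalities are instances of a maximum principle. The difference `w` of the larger and the
smaller function satisfies `l * w ≤ D w` with `l < 0`, where `D` is the ABC derivative. If `w` were
negative somewhere, it would have a negative minimum over some `[a, t]`, at a point `t₀ > a`. The
kernel `κ s = E_α(-μ (t₀ - s) ^ α)`, `μ = α / (1 - α)`, is nonnegative and increasing in `s`, so
integrating by parts against `w - w t₀ ≥ 0` gives `D w t₀ ≤ 0`, contradicting `l * w t₀ > 0`. At `a`
itself, `D w t → 0` as `t → a⁺` forces `w a ≥ 0`.

The sign and monotonicity of the kernel both follow from positivity of `r t = t ^ (α - 1) E_{α,α}(-μ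
t ^ α)` (`mlKernel_pos`): the kernel is `1 - μ ∫ r`, and also a fractional integral of `r` of order
`1 - α`. Positivity of `r` comes from its Volterra equation. Weak derivatives enter through
`HasWeakDeriv.eq_add_integral`, which makes continuous `H¹` functions absolutely continuous. -/

/-! ### Gamma quotients and two-parameter Mittag-Leffler functions. -/

theorem Real.Gamma_div_Gamma_add_le {s α : ℝ} (hs : 0 < s) (hα0 : 0 < α) (hα1 : α < 1) :
    Real.Gamma s / Real.Gamma (s + α) ≤ (s + α) ^ (1 - α) / s := by
  -- Log-convexity of Gamma, with `s + 1` as a convex combination of `s + α` and `s + α + 1`.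
  have h := Real.Gamma_mul_add_mul_le_rpow_Gamma_mul_rpow_Gamma (s := s + α) (t := s + α + 1)
    (by linarith) (by linarith) hα0 (sub_pos.2 hα1) (by ring)
  have e : α * (s + α) + (1 - α) * (s + α + 1) = s + 1 := by ring
  have hG := Real.Gamma_pos_of_pos (by linarith : 0 < s + α)
  rw [e, Real.Gamma_add_one hs.ne', Real.Gamma_add_one (by linarith),
    Real.mul_rpow (by linarith) hG.le, mul_left_comm, ← Real.rpow_add hG] at h
  simp only [add_sub_cancel, Real.rpow_one] at h
  rw [div_le_div_iff₀ hG hs]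
  linarith

theorem Real.tendsto_Gamma_div_Gamma_add {α : ℝ} (hα0 : 0 < α) (hα1 : α < 1) :
    Tendsto (fun s => Real.Gamma s / Real.Gamma (s + α)) atTop (𝓝 0) := by
  have h1 : Tendsto (fun s : ℝ => 2 * (s + α) ^ (-α)) atTop (𝓝 0) := by
    have := ((tendsto_rpow_neg_atTop hα0).comp
      (tendsto_atTop_add_const_right atTop α tendsto_id)).const_mul 2
    simpa using this
  refine tendsto_of_tendsto_of_tendsto_of_le_of_le' tendsto_const_nhds h1 ?_ ?_
  · filter_upwards [eventually_gt_atTop 0] with s hs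
    exact div_nonneg (Real.Gamma_pos_of_pos hs).le (Real.Gamma_pos_of_pos (by linarith)).le
  · filter_upwards [eventually_gt_atTop 0, eventually_gt_atTop α] with s hs hsα
    refine (Real.Gamma_div_Gamma_add_le hs hα0 hα1).trans ?_
    rw [sub_eq_add_neg, Real.rpow_add (by linarith), Real.rpow_one, div_le_iff₀ hs]
    have : 0 < (s + α) ^ (-α) := Real.rpow_pos_of_pos (by linarith) _
    nlinarith

/-- The two-parameter Mittag-Leffler function `E_{α,β}(z) = ∑_{k ≥ 0} z ^ k / Γ(α k + β)`. -/
noncomputable def mittagLeffler₂ (α β z : ℝ) : ℝ :=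
  ∑' k : ℕ, z ^ k / Real.Gamma (α * k + β)

theorem mittagLeffler_eq_mittagLeffler₂ (α z : ℝ) : mittagLeffler α z = mittagLeffler₂ α 1 z := rfl

section
variable {α β : ℝ}

theorem gamma_arg_pos (hα0 : 0 < α) (hβ : 0 < β) (k : ℕ) : 0 < α * k + β := by positivity

/-- Ratio test: consecutive terms have ratio `|z| Γ(x) / Γ(x + α)` with `x = α k + β → ∞`. -/
theorem summable_mittagLeffler₂ (hα0 : 0 < α) (hα1 : α < 1) (hβ : 0 < β) (z : ℝ) :
    Summable fun k : ℕ => z ^ k / Real.Gamma (α * k + β) := by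
  rcases eq_or_ne z 0 with rfl | hz
  · exact summable_of_ne_finset_zero (s := {0}) fun k hk => by simp_all
  have hG := fun k : ℕ => Real.Gamma_pos_of_pos (gamma_arg_pos hα0 hβ k)
  refine summable_of_ratio_test_tendsto_lt_one (l := 0) one_pos
    (Eventually.of_forall fun k => div_ne_zero (pow_ne_zero _ hz) (hG k).ne') ?_
  have ht : Tendsto (fun k : ℕ => α * (k : ℝ) + β) atTop atTop :=
    tendsto_atTop_add_const_right _ _ (tendsto_natCast_atTop_atTop.const_mul_atTop hα0)
  have := ((Real.tendsto_Gamma_div_Gamma_add hα0 hα1).comp ht).const_mul |z|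
  rw [mul_zero] at this
  refine this.congr fun k => ?_
  have e : α * ((k + 1 : ℕ) : ℝ) + β = α * k + β + α := by push_cast; ring
  have h1 := hG k
  have h2 := hG (k + 1)
  rw [e] at h2 ⊢
  have hz' : 0 < |z| := abs_pos.2 hz
  simp only [Function.comp_apply, norm_div, norm_pow, Real.norm_eq_abs, abs_of_pos h1,
    abs_of_pos h2]
  field_simp
  ring

theorem continuous_mittagLeffler₂ (hα0 : 0 < α) (hα1 : α < 1) (hβ : 0 < β) :
    Continuous (mittagLeffler₂ α β) := by
  rw [continuous_iff_continuousAt]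
  intro z
  have hc : ContinuousOn (mittagLeffler₂ α β) (Metric.ball 0 (|z| + 1)) := by
    refine continuousOn_tsum (fun k => by fun_prop)
      (summable_mittagLeffler₂ hα0 hα1 hβ (|z| + 1)) fun k x hx => ?_
    have hG := Real.Gamma_pos_of_pos (gamma_arg_pos hα0 hβ k)
    rw [norm_div, norm_pow, Real.norm_eq_abs (Real.Gamma _), abs_of_pos hG]
    have : ‖x‖ ≤ |z| + 1 := (mem_ball_zero_iff.1 hx).le
    gcongr
  exact hc.continuousAt (Metric.isOpen_ball.mem_nhds (by simp))

theorem mittagLeffler₂_zero : mittagLeffler₂ α β 0 = (Real.Gamma β)⁻¹ := by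
  rw [mittagLeffler₂, tsum_eq_single 0]
  · simp
  · intro k hk
    simp [hk]

theorem mittagLeffler₂_recurrence (hα0 : 0 < α) (hα1 : α < 1) (hβ : 0 < β) (z : ℝ) :
    mittagLeffler₂ α β z = (Real.Gamma β)⁻¹ + z * mittagLeffler₂ α (β + α) z := by
  rw [mittagLeffler₂, (summable_mittagLeffler₂ hα0 hα1 hβ z).tsum_eq_zero_add, mittagLeffler₂,
    ← tsum_mul_left]
  congr 1
  · simp
  · refine tsum_congr fun k => ?_
    rw [pow_succ', mul_div_assoc]
    congr 3
    push_cast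
    ring

/-- The function `t ^ (β - 1) E_{α,β}(-μ t ^ α)`. -/
noncomputable def mlKernel (α β μ t : ℝ) : ℝ :=
  t ^ (β - 1) * mittagLeffler₂ α β (-μ * t ^ α)

theorem continuous_mittagLeffler₂_rpow (hα0 : 0 < α) (hα1 : α < 1) (hβ : 0 < β) (μ : ℝ) :
    Continuous fun t : ℝ => mittagLeffler₂ α β (-μ * t ^ α) :=
  (continuous_mittagLeffler₂ hα0 hα1 hβ).comp
    (continuous_const.mul (Real.continuous_rpow_const hα0.le))

theorem continuousOn_mlKernel (hα0 : 0 < α) (hα1 : α < 1) (hβ : 0 < β) (μ : ℝ) :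
    ContinuousOn (mlKernel α β μ) (Ioi 0) := by
  refine ContinuousOn.mul (fun t ht => ?_)
    (continuous_mittagLeffler₂_rpow hα0 hα1 hβ μ).continuousOn
  exact (Real.continuousAt_rpow_const _ _ (Or.inl (ne_of_gt ht))).continuousWithinAt

theorem intervalIntegrable_mlKernel (hα0 : 0 < α) (hα1 : α < 1) (hβ : 0 < β) (μ t : ℝ) :
    IntervalIntegrable (mlKernel α β μ) volume 0 t :=
  (intervalIntegral.intervalIntegrable_rpow' (by linarith)).mul_continuousOn
    (continuous_mittagLeffler₂_rpow hα0 hα1 hβ μ).continuousOn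

theorem mlKernel_recurrence (hα0 : 0 < α) (hα1 : α < 1) (hβ : 0 < β) (μ : ℝ) {t : ℝ} (ht : 0 < t) :
    mlKernel α β μ t = t ^ (β - 1) / Real.Gamma β - μ * mlKernel α (β + α) μ t := by
  rw [mlKernel, mlKernel, mittagLeffler₂_recurrence hα0 hα1 hβ,
    show β + α - 1 = (β - 1) + α by ring, Real.rpow_add ht]
  ring

end

/-! ### Fractional integrals of powers and of Mittag-Leffler kernels. -/

theorem integral_sub_rpow_mul_rpow {p q t : ℝ} (hp : 0 < p) (hq : 0 < q) (ht : 0 < t) :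
    ∫ s in 0..t, (t - s) ^ (q - 1) * s ^ (p - 1) =
      t ^ (p + q - 1) * (Real.Gamma p * Real.Gamma q / Real.Gamma (p + q)) := by
  have h := Complex.betaIntegral_scaled p q ht
  rw [Complex.betaIntegral_eq_Gamma_mul_div _ _ (by simpa) (by simpa)] at h
  rw [← Complex.ofReal_add, Complex.Gamma_ofReal, Complex.Gamma_ofReal, Complex.Gamma_ofReal] at h
  apply Complex.ofReal_injective
  rw [← intervalIntegral.integral_ofReal]
  simp only [Complex.ofReal_mul, Complex.ofReal_div, Complex.ofReal_cpow ht.le, Complex.ofReal_sub,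
    Complex.ofReal_add, Complex.ofReal_one]
  simp only [Complex.ofReal_add] at h
  rw [← h]
  refine intervalIntegral.integral_congr_uIoo fun s hs => ?_
  rw [uIoo_of_le ht.le] at hs
  rw [Complex.ofReal_cpow (by linarith [hs.2]), Complex.ofReal_cpow hs.1.le, mul_comm]
  push_cast
  rfl

theorem intervalIntegrable_sub_rpow_mul_rpow {p q t : ℝ} (hp : 0 < p) (hq : 0 < q) (ht : 0 < t) :
    IntervalIntegrable (fun s => (t - s) ^ (q - 1) * s ^ (p - 1)) volume 0 t := by
  -- A non-integrable function has integral `0` by convention, so the nonzero Beta value forces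
  -- integrability.
  refine intervalIntegral.intervalIntegrable_of_integral_ne_zero ?_
  rw [integral_sub_rpow_mul_rpow hp hq ht]
  have := Real.Gamma_pos_of_pos hp
  have := Real.Gamma_pos_of_pos hq
  have := Real.Gamma_pos_of_pos (add_pos hp hq)
  positivity

section
variable {α β γ : ℝ}

theorem intervalIntegrable_sub_rpow_mul_mlKernel (hα0 : 0 < α) (hα1 : α < 1) (hβ : 0 < β)
    (hγ : 0 < γ) (μ : ℝ) {t : ℝ} (ht : 0 < t) :
    IntervalIntegrable (fun s => (t - s) ^ (γ - 1) * mlKernel α β μ s) volume 0 t := by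
  have := (intervalIntegrable_sub_rpow_mul_rpow hβ hγ ht).mul_continuousOn
    (continuous_mittagLeffler₂_rpow hα0 hα1 hβ μ).continuousOn
  simpa only [mlKernel, mul_assoc] using this

/-- Fractional integration of order `γ` shifts `β` to `β + γ`: integrate the series termwise with
the Beta integral. -/
theorem integral_sub_rpow_mul_mlKernel (hα0 : 0 < α) (hα1 : α < 1) (hβ : 0 < β)
    (hγ : 0 < γ) (μ : ℝ) {t : ℝ} (ht : 0 < t) :
    ∫ s in 0..t, (t - s) ^ (γ - 1) * mlKernel α β μ s =
      Real.Gamma γ * mlKernel α (β + γ) μ t := by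
  let F : ℕ → ℝ → ℝ := fun k s =>
    (-μ) ^ k / Real.Gamma (α * k + β) * ((t - s) ^ (γ - 1) * s ^ (α * k + β - 1))
  have hp := gamma_arg_pos hα0 hβ
  have hGp := fun k : ℕ => Real.Gamma_pos_of_pos (hp k)
  have hint : ∀ k, IntervalIntegrable (F k) volume 0 t := fun k =>
    (intervalIntegrable_sub_rpow_mul_rpow (hp k) hγ ht).const_mul _
  have htp : ∀ k : ℕ, t ^ (α * k + β + γ - 1) = t ^ (β + γ - 1) * (t ^ α) ^ k := fun k => by
    rw [← Real.rpow_natCast, ← Real.rpow_mul ht.le, ← Real.rpow_add ht]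
    ring_nf
  -- Used with `c = -μ` for the terms and with `c = |μ|` for their norms, whose sum is again a
  -- Mittag-Leffler series.
  have hval : ∀ (c : ℝ) (k : ℕ),
      c ^ k / Real.Gamma (α * k + β) * ∫ s in 0..t, (t - s) ^ (γ - 1) * s ^ (α * k + β - 1) =
        Real.Gamma γ * t ^ (β + γ - 1) * ((c * t ^ α) ^ k / Real.Gamma (α * k + (β + γ))) := by
    intro c k
    rw [integral_sub_rpow_mul_rpow (hp k) hγ ht, htp, mul_pow, ← add_assoc]
    have := (hGp k).ne'
    field_simp
  have hnorm : ∀ k, ∫ s in Ioc 0 t, ‖F k s‖ =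
      Real.Gamma γ * t ^ (β + γ - 1) * ((|μ| * t ^ α) ^ k / Real.Gamma (α * k + (β + γ))) := by
    intro k
    rw [← hval, ← intervalIntegral.integral_const_mul, intervalIntegral.integral_of_le ht.le]
    refine setIntegral_congr_fun measurableSet_Ioc fun s hs => ?_
    have h1 : 0 ≤ (t - s) ^ (γ - 1) := Real.rpow_nonneg (by linarith [hs.2]) _
    have h2 : 0 ≤ s ^ (α * k + β - 1) := Real.rpow_nonneg hs.1.le _
    simp only [F, norm_mul, norm_div, norm_pow, Real.norm_eq_abs, abs_neg, abs_of_nonneg h1,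
      abs_of_nonneg h2, abs_of_pos (hGp k)]
  have hs := hasSum_integral_of_summable_integral_norm (μ := volume.restrict (Ioc 0 t)) (F := F)
    (fun k => (intervalIntegrable_iff_integrableOn_Ioc_of_le ht.le).1 (hint k)) (by
      simp only [hnorm]
      exact (summable_mittagLeffler₂ hα0 hα1 (add_pos hβ hγ) _).mul_left _)
  have hR : ∀ k, ∫ s in Ioc 0 t, F k s =
      Real.Gamma γ * t ^ (β + γ - 1) * ((-μ * t ^ α) ^ k / Real.Gamma (α * k + (β + γ))) := by
    intro k
    rw [← hval, ← intervalIntegral.integral_const_mul, intervalIntegral.integral_of_le ht.le]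
  simp only [hR] at hs
  have e := hs.unique ((summable_mittagLeffler₂ hα0 hα1 (add_pos hβ hγ) (-μ * t ^ α)).hasSum.mul_left
    (Real.Gamma γ * t ^ (β + γ - 1)))
  rw [intervalIntegral.integral_of_le ht.le, mlKernel, ← mul_assoc, mittagLeffler₂, ← e]
  refine setIntegral_congr_fun measurableSet_Ioc fun s hs => ?_
  simp only [mlKernel, mittagLeffler₂, F, ← tsum_mul_left]
  refine tsum_congr fun k => ?_
  have : s ^ (α * k + β - 1) = s ^ (β - 1) * (s ^ α) ^ k := by
    rw [← Real.rpow_natCast, ← Real.rpow_mul hs.1.le, ← Real.rpow_add hs.1]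
    ring_nf
  rw [this, mul_pow]
  ring

end

theorem AbsolutelyContinuousOnInterval.congr {f g : ℝ → ℝ} {a b : ℝ}
    (hf : AbsolutelyContinuousOnInterval f a b) (h : EqOn f g (uIcc a b)) :
    AbsolutelyContinuousOnInterval g a b := by
  rw [absolutelyContinuousOnInterval_iff] at hf ⊢
  intro ε hε
  obtain ⟨δ, hδ, H⟩ := hf ε hε
  refine ⟨δ, hδ, fun E hE hlen => ?_⟩
  convert H E hE hlen using 1
  exact Finset.sum_congr rfl fun i hi => by rw [h (hE.1 i hi).1, h (hE.1 i hi).2]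

/-! ### Positivity and monotonicity of the Mittag-Leffler kernels. -/

section
variable {α μ : ℝ}

theorem sub_rpow_mul_rpow_le {p s t t₀ : ℝ} (hp : p ≤ 0) (hs : 0 ≤ s) (hst : s < t)
    (ht : t ≤ t₀) : (t₀ - s) ^ p * t ^ p ≤ t₀ ^ p * (t - s) ^ p := by
  rw [← Real.mul_rpow (by linarith) (by linarith), ← Real.mul_rpow (by linarith) (by linarith)]
  exact Real.rpow_le_rpow_of_nonpos (mul_pos (by linarith) (by linarith)) (by nlinarith) hp

/-- The Volterra equation `r = k - μ k * r` with `k t = t ^ (α - 1) / Γ(α)`. -/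
theorem mlKernel_volterra (hα0 : 0 < α) (hα1 : α < 1) {t : ℝ} (ht : 0 < t) :
    Real.Gamma α * mlKernel α α μ t =
      t ^ (α - 1) - μ * ∫ s in 0..t, (t - s) ^ (α - 1) * mlKernel α α μ s := by
  have := (Real.Gamma_pos_of_pos hα0).ne'
  rw [integral_sub_rpow_mul_mlKernel hα0 hα1 hα0 hα0 μ ht, mlKernel_recurrence hα0 hα1 hα0 μ ht]
  field_simp

/-- If `r ≥ 0` on `(0, t)` and `r ≤ r t` on `[t, t₀]`, then the Volterra equation bounds `r t₀`
from below in terms of `r t`. -/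
theorem mlKernel_lower_bound (hα0 : 0 < α) (hα1 : α < 1) (hμ : 0 ≤ μ) {t t₀ : ℝ} (ht : 0 < t)
    (htt : t < t₀) (hnn : ∀ s ∈ Ioo 0 t, 0 ≤ mlKernel α α μ s)
    (hmax : ∀ s ∈ Icc t t₀, mlKernel α α μ s ≤ mlKernel α α μ t) :
    mlKernel α α μ t * (Real.Gamma α * (t₀ ^ (α - 1) / t ^ (α - 1)) - μ * ((t₀ - t) ^ α / α)) ≤
      Real.Gamma α * mlKernel α α μ t₀ := by
  have ht₀ : 0 < t₀ := ht.trans htt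
  have hi := intervalIntegrable_sub_rpow_mul_mlKernel hα0 hα1 hα0 hα0 μ ht₀
  have hi1 := hi.mono_set (c := 0) (d := t) (uIcc_subset_uIcc left_mem_uIcc
    (by rw [uIcc_of_le ht₀.le]; exact ⟨ht.le, htt.le⟩))
  have hi2 := hi.mono_set (c := t) (d := t₀) (uIcc_subset_uIcc
    (by rw [uIcc_of_le ht₀.le]; exact ⟨ht.le, htt.le⟩) right_mem_uIcc)
  -- The convolution at `t₀` is split at `t`. The past part is compared with the convolution at `t`,
  -- the recent part is bounded by the maximum `r t`.
  have hk : 0 < t ^ (α - 1) := Real.rpow_pos_of_pos ht _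
  have hJ1 : ∫ s in 0..t, (t₀ - s) ^ (α - 1) * mlKernel α α μ s ≤
      t₀ ^ (α - 1) / t ^ (α - 1) * ∫ s in 0..t, (t - s) ^ (α - 1) * mlKernel α α μ s := by
    rw [← intervalIntegral.integral_const_mul]
    refine intervalIntegral.integral_mono_on_of_le_Ioo ht.le hi1
      ((intervalIntegrable_sub_rpow_mul_mlKernel hα0 hα1 hα0 hα0 μ ht).const_mul _) fun s hs => ?_
    rw [← mul_assoc]
    refine mul_le_mul_of_nonneg_right ?_ (hnn s hs)
    rw [div_mul_eq_mul_div, le_div_iff₀ hk]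
    exact sub_rpow_mul_rpow_le (by linarith) hs.1.le hs.2 htt.le
  have hpow : IntervalIntegrable (fun s : ℝ => (t₀ - s) ^ (α - 1)) volume t t₀ := by
    have := (intervalIntegral.intervalIntegrable_rpow' (a := t₀ - t) (b := 0) (r := α - 1)
      (by linarith)).comp_sub_left t₀
    simpa using this
  have hJ2 : ∫ s in t..t₀, (t₀ - s) ^ (α - 1) * mlKernel α α μ s ≤
      (t₀ - t) ^ α / α * mlKernel α α μ t := by
    have e : ∫ s in t..t₀, (t₀ - s) ^ (α - 1) = (t₀ - t) ^ α / α := by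
      rw [intervalIntegral.integral_comp_sub_left (fun x => x ^ (α - 1)), sub_self,
        integral_rpow (Or.inl (by linarith))]
      simp [Real.zero_rpow hα0.ne']
    rw [← e, ← intervalIntegral.integral_mul_const]
    refine intervalIntegral.integral_mono_on htt.le hi2 (hpow.mul_const _) fun s hs => ?_
    exact mul_le_mul_of_nonneg_left (hmax s hs) (Real.rpow_nonneg (by linarith [hs.2]) _)
  have hV := mlKernel_volterra (μ := μ) hα0 hα1 ht
  rw [mlKernel_volterra hα0 hα1 ht₀, ← intervalIntegral.integral_add_adjacent_intervals hi1 hi2]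
  have h1 := mul_le_mul_of_nonneg_left hJ1 hμ
  have h2 := mul_le_mul_of_nonneg_left hJ2 hμ
  -- By the Volterra equation at `t`, the scaled past part has forcing term exactly `t₀ ^ (α - 1)`,
  -- which cancels the one at `t₀`.
  have h3 : t₀ ^ (α - 1) / t ^ (α - 1) *
      (μ * ∫ s in 0..t, (t - s) ^ (α - 1) * mlKernel α α μ s) =
      t₀ ^ (α - 1) - t₀ ^ (α - 1) / t ^ (α - 1) * (Real.Gamma α * mlKernel α α μ t) := by
    rw [hV]
    field_simp
    ring
  linarith

theorem mlKernel_pos (hα0 : 0 < α) (hα1 : α < 1) (hμ : 0 ≤ μ) {t : ℝ} (ht : 0 < t) :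
    0 < mlKernel α α μ t := by
  by_contra! hneg
  -- `F` has the sign of `r` on `(0, ∞)` but is continuous at `0` with `F 0 > 0`, so a first point
  -- `t₀ > 0` with `F ≤ 0` exists.
  let F : ℝ → ℝ := fun t => mittagLeffler₂ α α (-μ * t ^ α)
  have hF : Continuous F := continuous_mittagLeffler₂_rpow hα0 hα1 hα0 μ
  have hr : ∀ s > 0, (0 < mlKernel α α μ s ↔ 0 < F s) := fun s hs =>
    mul_pos_iff_of_pos_left (Real.rpow_pos_of_pos hs _)
  have hΓ := Real.Gamma_pos_of_pos hα0
  have hF0 : 0 < F 0 := by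
    simp only [F, Real.zero_rpow hα0.ne', mul_zero, mittagLeffler₂_zero]
    positivity
  let S : Set ℝ := Ici 0 ∩ {s | F s ≤ 0}
  have hScl : IsClosed S := isClosed_Ici.inter (isClosed_le hF continuous_const)
  have hSne : S.Nonempty := ⟨t, ht.le, not_lt.1 fun h => absurd ((hr t ht).2 h) hneg.not_gt⟩
  have hSbd : BddBelow S := ⟨0, fun s hs => hs.1⟩
  set t₀ := sInf S
  have ht₀S : t₀ ∈ S := hScl.csInf_mem hSne hSbd
  have ht₀ : 0 < t₀ := lt_of_le_of_ne ht₀S.1 fun h => absurd ht₀S.2 (by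
    simp only [mem_ofPred_eq, not_le]; rwa [← h])
  have hpos : ∀ s ∈ Ioo 0 t₀, 0 < mlKernel α α μ s := fun s hs => (hr s hs.1).2 (by
    by_contra! h
    exact absurd (csInf_le hSbd (⟨hs.1.le, h⟩ : s ∈ S)) hs.2.not_ge)
  have hr₀ : mlKernel α α μ t₀ ≤ 0 := not_lt.1 fun h => absurd ((hr t₀ ht₀).1 h) ht₀S.2.not_gt
  -- With `τ` a maximum point of `r` on `[t₀ - ε, t₀]`, `ε < t₀ / 2` gives `t₀ ^ (α - 1) / τ ^ (α -
  -- 1) ≥ 1 / 2`. The second bound then makes the factor in `mlKernel_lower_bound` positive, so `r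
  -- t₀ > 0`, a contradiction.
  obtain ⟨ε, hε0, hεt, hε⟩ : ∃ ε > 0, ε < t₀ / 2 ∧ μ * (ε ^ α / α) < Real.Gamma α / 2 := by
    have hc : Continuous fun ε : ℝ => μ * (ε ^ α / α) :=
      continuous_const.mul ((Real.continuous_rpow_const hα0.le).div_const _)
    have h1 : ∀ᶠ ε in 𝓝 (0 : ℝ), μ * (ε ^ α / α) < Real.Gamma α / 2 :=
      hc.continuousAt.eventually_lt_const (by simp [Real.zero_rpow hα0.ne', hΓ])
    have h2 : ∀ᶠ ε in 𝓝 (0 : ℝ), ε < t₀ / 2 := eventually_lt_nhds (by linarith)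
    obtain ⟨ε, ⟨h3, h4⟩, h5⟩ := (((h2.and h1).filter_mono nhdsWithin_le_nhds).and
      (self_mem_nhdsWithin (s := Ioi (0 : ℝ)))).exists
    exact ⟨ε, h5, h3, h4⟩
  obtain ⟨τ, hτ, hmax⟩ := isCompact_Icc.exists_isMaxOn (nonempty_Icc.2 (by linarith : t₀ - ε ≤ t₀))
    ((continuousOn_mlKernel hα0 hα1 hα0 μ).mono fun s (hs : s ∈ Icc (t₀ - ε) t₀) => by
      simp only [mem_Ioi]; linarith [hs.1])
  have hτ0 : 0 < τ := by linarith [hτ.1]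
  have hrτ : 0 < mlKernel α α μ τ :=
    (hpos (t₀ - ε) ⟨by linarith, by linarith⟩).trans_le (hmax ⟨le_rfl, by linarith⟩)
  have hττ : τ < t₀ := lt_of_le_of_ne hτ.2 fun h => by rw [h] at hrτ; linarith
  have hlow := mlKernel_lower_bound hα0 hα1 hμ hτ0 hττ
    (fun s hs => (hpos s ⟨hs.1, hs.2.trans hττ⟩).le)
    (fun s hs => hmax ⟨hτ.1.trans hs.1, hs.2⟩)
  have hk : 1 / 2 ≤ t₀ ^ (α - 1) / τ ^ (α - 1) := by
    rw [← Real.div_rpow ht₀.le hτ0.le, ← neg_sub 1 α, Real.rpow_neg (by positivity),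
      ← Real.inv_rpow (by positivity), inv_div]
    have h1 : τ / t₀ ≤ 1 := (div_le_one ht₀).2 hττ.le
    have h2 : 1 / 2 ≤ τ / t₀ := by rw [le_div_iff₀ ht₀]; linarith [hτ.1]
    refine h2.trans ?_
    simpa using Real.rpow_le_rpow_of_exponent_ge (by positivity) h1 (by linarith : 1 - α ≤ 1)
  have hm : μ * ((t₀ - τ) ^ α / α) ≤ μ * (ε ^ α / α) := by
    have h1 : t₀ - τ ≤ ε := by linarith [hτ.1]
    have h2 : 0 ≤ t₀ - τ := by linarith
    gcongr
  have hG : Real.Gamma α / 2 ≤ Real.Gamma α * (t₀ ^ (α - 1) / τ ^ (α - 1)) := by nlinarith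
  have := mul_pos hrτ (by linarith :
    0 < Real.Gamma α * (t₀ ^ (α - 1) / τ ^ (α - 1)) - μ * ((t₀ - τ) ^ α / α))
  nlinarith

theorem mittagLeffler_eq_mlKernel (μ t : ℝ) :
    mittagLeffler α (-μ * t ^ α) = mlKernel α 1 μ t := by
  simp [mlKernel, mittagLeffler_eq_mittagLeffler₂]

theorem mittagLeffler_eq_one_sub_integral (hα0 : 0 < α) (hα1 : α < 1) (μ : ℝ) {t : ℝ}
    (ht : 0 ≤ t) : mittagLeffler α (-μ * t ^ α) = 1 - μ * ∫ s in 0..t, mlKernel α α μ s := by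
  rcases ht.eq_or_lt with rfl | ht
  · simp [Real.zero_rpow hα0.ne', mittagLeffler_eq_mittagLeffler₂, mittagLeffler₂_zero]
  · have := integral_sub_rpow_mul_mlKernel hα0 hα1 hα0 one_pos μ ht
    simp only [sub_self, Real.rpow_zero, one_mul, Real.Gamma_one] at this
    rw [this, mittagLeffler_eq_mlKernel, mlKernel_recurrence hα0 hα1 one_pos μ ht, add_comm 1 α]
    simp

theorem mittagLeffler_nonneg (hα0 : 0 < α) (hα1 : α < 1) (hμ : 0 ≤ μ) {t : ℝ}
    (ht : 0 ≤ t) : 0 ≤ mittagLeffler α (-μ * t ^ α) := by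
  rcases ht.eq_or_lt with rfl | ht
  · rw [mittagLeffler_eq_one_sub_integral hα0 hα1 μ le_rfl]
    simp
  · have h := integral_sub_rpow_mul_mlKernel hα0 hα1 hα0 (sub_pos.2 hα1) μ ht
    rw [add_sub_cancel, ← mittagLeffler_eq_mlKernel] at h
    have hΓ := Real.Gamma_pos_of_pos (sub_pos.2 hα1)
    have h0 : 0 ≤ ∫ s in 0..t, (t - s) ^ (1 - α - 1) * mlKernel α α μ s := by
      rw [intervalIntegral.integral_of_le ht.le]
      exact setIntegral_nonneg measurableSet_Ioc fun s hs =>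
        mul_nonneg (Real.rpow_nonneg (by linarith [hs.2]) _) (mlKernel_pos hα0 hα1 hμ hs.1).le
    rw [h] at h0
    exact nonneg_of_mul_nonneg_right h0 hΓ

theorem antitoneOn_mittagLeffler (hα0 : 0 < α) (hα1 : α < 1) (hμ : 0 ≤ μ) :
    AntitoneOn (fun t : ℝ => mittagLeffler α (-μ * t ^ α)) (Ici 0) := by
  intro x hx y hy hxy
  have hx : 0 ≤ x := hx
  have hy : 0 ≤ y := hy
  simp only
  rw [mittagLeffler_eq_one_sub_integral hα0 hα1 μ hx, mittagLeffler_eq_one_sub_integral hα0 hα1 μ hy]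
  have hi := fun t => intervalIntegrable_mlKernel hα0 hα1 hα0 μ t
  have e := intervalIntegral.integral_add_adjacent_intervals (hi x) ((hi x).symm.trans (hi y))
  have : 0 ≤ ∫ s in x..y, mlKernel α α μ s := by
    rw [intervalIntegral.integral_of_le hxy]
    exact setIntegral_nonneg measurableSet_Ioc fun s hs =>
      (mlKernel_pos hα0 hα1 hμ (hx.trans_lt hs.1)).le
  rw [← e]
  nlinarith

theorem mittagLeffler_le_one (hα0 : 0 < α) (hα1 : α < 1) (hμ : 0 ≤ μ) {t : ℝ}
    (ht : 0 ≤ t) : mittagLeffler α (-μ * t ^ α) ≤ 1 := by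
  have h := antitoneOn_mittagLeffler hα0 hα1 hμ (mem_Ici.2 le_rfl) ht ht
  simp only [mittagLeffler_eq_one_sub_integral hα0 hα1 μ le_rfl, intervalIntegral.integral_same,
    mul_zero, sub_zero] at h
  exact h

theorem continuous_mittagLeffler_rpow (hα0 : 0 < α) (hα1 : α < 1) (μ : ℝ) :
    Continuous fun t : ℝ => mittagLeffler α (-μ * t ^ α) :=
  continuous_mittagLeffler₂_rpow hα0 hα1 one_pos μ

/-- Needed for integration by parts. The power `(t₀ - s) ^ α` is not Lipschitz at `s = t₀`, so
absolute continuity is read off from the integral of the integrable `r`. -/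
theorem absolutelyContinuousOnInterval_mittagLeffler (hα0 : 0 < α) (hα1 : α < 1) (μ : ℝ)
    {a t₀ : ℝ} (ha : a ≤ t₀) :
    AbsolutelyContinuousOnInterval (fun s => mittagLeffler α (-μ * (t₀ - s) ^ α)) a t₀ := by
  have hi : IntervalIntegrable (fun s => mlKernel α α μ (t₀ - s)) volume a t₀ := by
    have := (intervalIntegrable_mlKernel hα0 hα1 hα0 μ (t₀ - a)).comp_sub_left t₀
    simpa using this.symm
  have hac := ((hi.absolutelyContinuousOnInterval_intervalIntegral (c := t₀)
    right_mem_uIcc).const_mul μ)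
  have hone : AbsolutelyContinuousOnInterval (fun _ : ℝ => (1 : ℝ)) a t₀ :=
    (LipschitzWith.const (1 : ℝ)).lipschitzOnWith.absolutelyContinuousOnInterval
  refine (hone.add hac).congr fun s hs => ?_
  rw [uIcc_of_le ha] at hs
  simp only [Pi.add_apply]
  rw [mittagLeffler_eq_one_sub_integral hα0 hα1 μ (sub_nonneg.2 hs.2),
    intervalIntegral.integral_comp_sub_left (fun x => mlKernel α α μ x), sub_self,
    intervalIntegral.integral_symm]
  ring

end

/-! ### Weak derivatives and the fundamental theorem of calculus. -/

/-- The primitive from `a` vanishes to the left of `K`, and to the right of it because the total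
integral is zero. -/
theorem exists_tsupport_subset_Ioo_deriv_eq {a b : ℝ} {θ : ℝ → ℝ} {K : Set ℝ}
    (hθ : ContDiff ℝ ∞ θ) (hK : IsCompact K) (hKne : K.Nonempty) (hKab : K ⊆ Ioo a b)
    (hsupp : Function.support θ ⊆ K) (hint : ∫ x, θ x = 0) :
    ∃ Φ : ℝ → ℝ, ContDiff ℝ ∞ Φ ∧ HasCompactSupport Φ ∧ tsupport Φ ⊆ Ioo a b ∧ deriv Φ = θ := by
  have hc := hKab (hK.sInf_mem hKne)
  have hd := hKab (hK.sSup_mem hKne)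
  have hKcd : K ⊆ Icc (sInf K) (sSup K) := fun x hx =>
    ⟨csInf_le hK.bddBelow hx, le_csSup hK.bddAbove hx⟩
  have hder : ∀ x, HasDerivAt (fun x => ∫ y in a..x, θ y) (θ x) x := fun x =>
    intervalIntegral.integral_hasDerivAt_right (hθ.continuous.intervalIntegrable _ _)
      (hθ.continuous.stronglyMeasurableAtFilter _ _) hθ.continuous.continuousAt
  have hderiv : deriv (fun x => ∫ y in a..x, θ y) = θ := funext fun x => (hder x).deriv
  have hsup : Function.support (fun x => ∫ y in a..x, θ y) ⊆ Icc (sInf K) (sSup K) := by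
    intro x hx
    by_contra hx'
    apply hx
    rw [mem_Icc, not_and_or, not_le, not_le] at hx'
    rcases hx' with hx' | hx'
    · refine (intervalIntegral.integral_congr (g := fun _ => 0) fun y hy => ?_).trans (by simp)
      by_contra hy'
      have := (hKcd (hsupp hy')).1
      have := hy.2
      rcases max_cases a x with h | h <;> linarith [hc.1]
    · refine (intervalIntegral.integral_eq_integral_of_support_subset fun y hy => ?_).trans hint
      have := hKcd (hsupp hy)
      exact ⟨hc.1.trans_le this.1, this.2.trans hx'.le⟩
  have hts := closure_minimal hsup isClosed_Icc
  refine ⟨fun x => ∫ y in a..x, θ y, ?_, isCompact_Icc.of_isClosed_subset (isClosed_tsupport _) hts,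
    hts.trans fun x hx => ⟨hc.1.trans_le hx.1, hx.2.trans_lt hd.2⟩, hderiv⟩
  rw [contDiff_infty_iff_deriv, hderiv]
  exact ⟨fun x => (hder x).differentiableAt, hθ⟩

/-- A continuous function on `[a, b]` whose weak derivative on `(a, b)` vanishes is constant. -/
theorem eqOn_const_of_integral_mul_deriv_eq_zero {a b : ℝ} (hab : a < b) {D : ℝ → ℝ}
    (hD : ContinuousOn D (Icc a b))
    (h : ∀ φ : ℝ → ℝ, ContDiff ℝ ∞ φ → HasCompactSupport φ → tsupport φ ⊆ Ioo a b →
      ∫ x in Ioo a b, D x * deriv φ x = 0) : ∃ C, EqOn D (fun _ => C) (Icc a b) := by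
  let ψ : ContDiffBump ((a + b) / 2) := ⟨(b - a) / 8, (b - a) / 4, by linarith, by linarith⟩
  have hball : Metric.closedBall ((a + b) / 2) ψ.rOut ⊆ Ioo a b := by
    rw [Real.closedBall_eq_Icc]
    intro x hx
    simp only [ψ, mem_Icc] at hx
    constructor <;> linarith [hx.1, hx.2]
  have hi : ∀ φ : ℝ → ℝ, Continuous φ → IntegrableOn (fun x => D x * φ x) (Ioo a b) := fun φ hφ =>
    (ContinuousOn.mul hD hφ.continuousOn).integrableOn_Icc.mono_set Ioo_subset_Icc_self
  have hψ : Continuous (ψ.normed volume) := ψ.continuous_normed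
  refine ⟨∫ x in Ioo a b, D x * ψ.normed volume x, ?_⟩
  set C := ∫ x in Ioo a b, D x * ψ.normed volume x
  have hae := isOpen_Ioo.ae_eq_zero_of_integral_contDiff_smul_eq_zero (U := Ioo a b) (μ := volume)
    (f := fun x => D x - C) (((hD.sub continuousOn_const).mono Ioo_subset_Icc_self).locallyIntegrableOn
      measurableSet_Ioo) fun φ hφ hc hs => by
    -- Du Bois-Reymond: subtracting a multiple of a bump of mass one gives mean zero, so `θ` is the
    -- derivative of an admissible test function.
    let θ : ℝ → ℝ := fun x => φ x - (∫ y, φ y) * ψ.normed volume x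
    obtain ⟨Φ, hΦ, hΦc, hΦs, hΦd⟩ := exists_tsupport_subset_Ioo_deriv_eq (a := a) (b := b) (θ := θ)
      (K := tsupport φ ∪ Metric.closedBall ((a + b) / 2) ψ.rOut)
      (hφ.sub (contDiff_const.mul ψ.contDiff_normed))
      (hc.isCompact.union (isCompact_closedBall _ _))
      ((Metric.nonempty_closedBall.2 ψ.rOut_pos.le).mono subset_union_right)
      (union_subset hs hball) (fun x hx => by
        by_contra hx'
        rw [mem_union, not_or] at hx'
        apply hx
        have h2 : ψ.normed volume x = 0 := by
          apply image_eq_zero_of_notMem_tsupport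
          rw [ψ.tsupport_normed_eq]
          exact hx'.2
        simp [θ, image_eq_zero_of_notMem_tsupport hx'.1, h2])
      (by
        simp only [θ]
        rw [integral_sub (hφ.continuous.integrable_of_hasCompactSupport hc)
          (ψ.integrable_normed.const_mul _), integral_const_mul, ψ.integral_normed]
        ring)
    have h1 := h Φ hΦ hΦc hΦs
    rw [hΦd] at h1
    have e : ∀ x, D x * θ x = D x * φ x - (∫ y, φ y) * (D x * ψ.normed volume x) := fun x => by
      simp only [θ]; ring
    simp only [e] at h1
    rw [integral_sub (hi φ hφ.continuous) ((hi _ hψ).const_mul _), integral_const_mul] at h1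
    have hz : ∀ x ∉ Ioo a b, φ x = 0 := fun x hx =>
      image_eq_zero_of_notMem_tsupport fun hx' => hx (hs hx')
    have hφi : ∫ y, φ y = ∫ y in Ioo a b, φ y :=
      (setIntegral_eq_integral_of_forall_compl_eq_zero hz).symm
    rw [← setIntegral_eq_integral_of_forall_compl_eq_zero (s := Ioo a b)
      (fun x hx => by simp [hz x hx])]
    have e2 : ∀ x, φ x • (D x - C) = D x * φ x - C * φ x := fun x => by
      rw [smul_eq_mul]; ring
    simp only [e2]
    rw [integral_sub (hi φ hφ.continuous)
      ((hφ.continuous.integrable_of_hasCompactSupport hc).integrableOn.const_mul _),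
      integral_const_mul, ← hφi]
    linarith
  refine Measure.eqOn_Icc_of_ae_eq volume hab.ne ?_ hD continuousOn_const
  rw [EventuallyEq, ← restrict_Ioo_eq_restrict_Icc, ae_restrict_iff' measurableSet_Ioo]
  filter_upwards [hae] with x hx hxI
  exact sub_eq_zero.1 (hx hxI)

theorem ae_deriv_eq_of_eq_add_integral {a b : ℝ} (hab : a ≤ b) {w g : ℝ → ℝ}
    (hg : IntervalIntegrable g volume a b) (hw : ∀ t ∈ Icc a b, w t = w a + ∫ x in a..t, g x) :
    ∀ᵐ x, x ∈ Ioo a b → deriv w x = g x := by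
  filter_upwards [hg.ae_hasDerivAt_integral] with x hx hxI
  have h := (hx (by rw [uIcc_of_le hab]; exact Ioo_subset_Icc_self hxI) a left_mem_uIcc).const_add
    (w a)
  refine (h.congr_of_eventuallyEq ?_).deriv
  filter_upwards [Icc_mem_nhds hxI.1 hxI.2] with t ht using hw t ht

theorem absolutelyContinuousOnInterval_of_eq_add_integral {a b : ℝ} (hab : a ≤ b) {w g : ℝ → ℝ}
    (hg : IntervalIntegrable g volume a b) (hw : ∀ t ∈ Icc a b, w t = w a + ∫ x in a..t, g x) :
    AbsolutelyContinuousOnInterval w a b := by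
  have hc : AbsolutelyContinuousOnInterval (fun _ : ℝ => w a) a b :=
    (LipschitzWith.const (w a)).lipschitzOnWith.absolutelyContinuousOnInterval
  refine (hc.add (hg.absolutelyContinuousOnInterval_intervalIntegral left_mem_uIcc)).congr ?_
  intro t ht
  rw [uIcc_of_le hab] at ht
  exact (hw t ht).symm

/-- The fundamental theorem of calculus for continuous functions with an integrable weak
derivative. -/
theorem HasWeakDeriv.eq_add_integral {a b : ℝ} (hab : a < b) {w g : ℝ → ℝ}
    (h : HasWeakDeriv a b w g) (hg : IntervalIntegrable g volume a b)
    (hw : ContinuousOn w (Icc a b)) : ∀ t ∈ Icc a b, w t = w a + ∫ x in a..t, g x := by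
  let W : ℝ → ℝ := fun t => ∫ x in a..t, g x
  have hWac : AbsolutelyContinuousOnInterval W a b :=
    hg.absolutelyContinuousOnInterval_intervalIntegral left_mem_uIcc
  have hWc : ContinuousOn W (Icc a b) := by
    have := hWac.continuousOn
    rwa [uIcc_of_le hab.le] at this
  have hWd := ae_deriv_eq_of_eq_add_integral hab.le (w := W) hg (by simp [W])
  -- `w` and the primitive `W` of `g` have the same weak derivative, so `w - W` is constant.
  obtain ⟨C, hC⟩ := eqOn_const_of_integral_mul_deriv_eq_zero hab (hw.sub hWc)
    fun φ hφ hc hs => by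
      have h1 := h.2.2 φ hφ hc hs
      have hφac : AbsolutelyContinuousOnInterval φ a b :=
        (hφ.of_le (by simp)).contDiffOn.absolutelyContinuousOnInterval
      have h2 := hWac.integral_mul_deriv_eq_deriv_mul hφac
      have ha : φ a = 0 := image_eq_zero_of_notMem_tsupport fun h => lt_irrefl _ (hs h).1
      have hb : φ b = 0 := image_eq_zero_of_notMem_tsupport fun h => lt_irrefl _ (hs h).2
      rw [ha, hb, intervalIntegral.integral_of_le hab.le, intervalIntegral.integral_of_le hab.le,
        integral_Ioc_eq_integral_Ioo, integral_Ioc_eq_integral_Ioo] at h2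
      have h3 : ∫ x in Ioo a b, deriv W x * φ x = ∫ x in Ioo a b, g x * φ x := by
        refine setIntegral_congr_ae measurableSet_Ioo ?_
        filter_upwards [hWd] with x hx hxI
        rw [hx hxI]
      have hφ' : Continuous (deriv φ) := hφ.continuous_deriv (by simp)
      have hi : ∀ f, ContinuousOn f (Icc a b) →
          IntegrableOn (fun x => f x * deriv φ x) (Ioo a b) := fun f hf =>
        (ContinuousOn.mul hf hφ'.continuousOn).integrableOn_Icc.mono_set Ioo_subset_Icc_self
      simp only [Pi.sub_apply, sub_mul]
      rw [integral_sub (hi w hw) (hi W hWc), h1, h2, h3]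
      ring
  intro t ht
  have h1 := hC ht
  have h2 := hC (left_mem_Icc.2 hab.le)
  simp only [Pi.sub_apply, W, intervalIntegral.integral_same] at h1 h2
  linarith

theorem MemH1.hasWeakDeriv_weakDeriv {a b : ℝ} {w : ℝ → ℝ} (h : MemH1 a b w) :
    HasWeakDeriv a b w (weakDeriv a b w) := by
  obtain ⟨-, g, -, hg⟩ := h
  have hex : ∃ g, HasWeakDeriv a b w g := ⟨g, hg⟩
  rw [weakDeriv, dif_pos hex]
  exact hex.choose_spec

/-- The chosen representative agrees a.e. with the square-integrable one, which is integrable on a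
bounded interval. -/
theorem MemH1.intervalIntegrable_weakDeriv {a b : ℝ} (hab : a ≤ b) {w : ℝ → ℝ}
    (h : MemH1 a b w) : IntervalIntegrable (weakDeriv a b w) volume a b := by
  obtain ⟨-, g, hg2, hg⟩ := id h
  have hgi : IntegrableOn g (Ioo a b) := hg2.integrable (by norm_num)
  rw [intervalIntegrable_iff_integrableOn_Ioo_of_le hab]
  refine hgi.congr ?_
  rw [EventuallyEq, ae_restrict_iff' measurableSet_Ioo]
  exact hg.ae_eq h.hasWeakDeriv_weakDeriv

/-! ### The comparison principle. -/

/-- At a minimum point `c` of `w` on `[a, c]`, the integral of `w'` against a nonnegative monotone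
kernel is nonpositive. -/
theorem integral_mul_nonpos_of_isMin {a c : ℝ} (hac : a ≤ c) {κ w g : ℝ → ℝ}
    (hκ : AbsolutelyContinuousOnInterval κ a c) (hmono : MonotoneOn κ (Icc a c)) (hκa : 0 ≤ κ a)
    (hg : IntervalIntegrable g volume a c) (hw : ∀ t ∈ Icc a c, w t = w a + ∫ x in a..t, g x)
    (hmin : ∀ s ∈ Icc a c, w c ≤ w s) : ∫ s in a..c, κ s * g s ≤ 0 := by
  -- Shifting by `w c` removes the boundary term at `c`; the one at `a` and the remaining integral
  -- then have the right sign.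
  have hw' : ∀ t ∈ Icc a c, w t - w c = w a - w c + ∫ x in a..t, g x := fun t ht => by
    rw [hw t ht]; ring
  have hac' := absolutelyContinuousOnInterval_of_eq_add_integral hac (w := fun t => w t - w c) hg hw'
  have hd := ae_deriv_eq_of_eq_add_integral hac (w := fun t => w t - w c) hg hw'
  have hibp := hκ.integral_mul_deriv_eq_deriv_mul hac'
  have e : ∫ s in a..c, κ s * g s = ∫ s in a..c, κ s * deriv (fun t => w t - w c) s := by
    rw [intervalIntegral.integral_of_le hac, intervalIntegral.integral_of_le hac,
      integral_Ioc_eq_integral_Ioo, integral_Ioc_eq_integral_Ioo]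
    refine setIntegral_congr_ae measurableSet_Ioo ?_
    filter_upwards [hd] with x hx hxI
    rw [hx hxI]
  have hnn : 0 ≤ ∫ s in a..c, deriv κ s * (w s - w c) := by
    rw [intervalIntegral.integral_of_le hac, integral_Ioc_eq_integral_Ioo]
    refine setIntegral_nonneg measurableSet_Ioo fun s hs =>
      mul_nonneg ?_ (sub_nonneg.2 (hmin s (Ioo_subset_Icc_self hs)))
    rw [← derivWithin_of_mem_nhds (Icc_mem_nhds hs.1 hs.2)]
    exact hmono.derivWithin_nonneg
  have := mul_nonneg hκa (sub_nonneg.2 (hmin a (left_mem_Icc.2 hac)))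
  rw [e, hibp]
  simp only [sub_self, mul_zero]
  linarith

section
variable {α μ a b : ℝ}

theorem intervalIntegrable_mittagLeffler_mul (hα0 : 0 < α) (hα1 : α < 1) (μ : ℝ) {g : ℝ → ℝ}
    (hg : IntervalIntegrable g volume a b) {t : ℝ} (ht : t ∈ Icc a b) :
    IntervalIntegrable (fun s => mittagLeffler α (-μ * (t - s) ^ α) * g s) volume a t := by
  have hc : Continuous fun s : ℝ => mittagLeffler α (-μ * (t - s) ^ α) :=
    (continuous_mittagLeffler_rpow hα0 hα1 μ).comp (continuous_const.sub continuous_id)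
  refine (hg.mono_set ?_).continuousOn_mul hc.continuousOn
  rw [uIcc_of_le ht.1, uIcc_of_le (ht.1.trans ht.2)]
  exact Icc_subset_Icc_right ht.2

theorem tendsto_integral_mittagLeffler_mul (hα0 : 0 < α) (hα1 : α < 1) (hμ : 0 ≤ μ)
    (hab : a < b) {g : ℝ → ℝ} (hg : IntervalIntegrable g volume a b) :
    Tendsto (fun t => ∫ s in a..t, mittagLeffler α (-μ * (t - s) ^ α) * g s) (𝓝[>] a) (𝓝 0) := by
  have hIcc : Icc a b ∈ 𝓝[>] a := Icc_mem_nhdsGT hab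
  have hcont : Tendsto (fun t => ∫ s in a..t, |g s|) (𝓝[>] a) (𝓝 0) := by
    have hgi : IntegrableOn (fun s => |g s|) (uIcc a b) := by
      rw [uIcc_of_le hab.le]
      exact (intervalIntegrable_iff_integrableOn_Icc_of_le hab.le).1 hg.abs
    have := intervalIntegral.continuousOn_primitive_interval hgi a left_mem_uIcc
    rw [uIcc_of_le hab.le] at this
    have h := this.tendsto
    rw [intervalIntegral.integral_same] at h
    exact h.mono_left (nhdsWithin_le_iff.2 hIcc)
  refine squeeze_zero_norm' ?_ hcont
  filter_upwards [hIcc] with t ht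
  refine (intervalIntegral.norm_integral_le_integral_norm ht.1).trans ?_
  refine intervalIntegral.integral_mono_on ht.1
    (intervalIntegrable_mittagLeffler_mul hα0 hα1 μ hg ht).norm (hg.abs.mono_set ?_) fun s hs => ?_
  · rw [uIcc_of_le ht.1, uIcc_of_le hab.le]
    exact Icc_subset_Icc_right ht.2
  · have h0 := mittagLeffler_nonneg hα0 hα1 hμ (sub_nonneg.2 hs.2)
    have h1 := mittagLeffler_le_one hα0 hα1 hμ (sub_nonneg.2 hs.2)
    rw [norm_mul, Real.norm_eq_abs, Real.norm_eq_abs, abs_of_nonneg h0]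
    exact mul_le_of_le_one_left (abs_nonneg _) h1

/-- Comparison principle: a function `w` with integrable derivative `g` satisfying
`l w ≤ c ∫ E_α(-μ (t - s) ^ α) g` with `l < 0 < c` is nonnegative. -/
theorem nonneg_of_le_integral_mittagLeffler_mul (hα0 : 0 < α) (hα1 : α < 1) (hμ : 0 ≤ μ)
    (hab : a < b) {c l : ℝ} (hc : 0 < c) (hl : l < 0) {w g : ℝ → ℝ}
    (hwc : ContinuousOn w (Icc a b)) (hg : IntervalIntegrable g volume a b)
    (hw : ∀ t ∈ Icc a b, w t = w a + ∫ x in a..t, g x)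
    (h : ∀ t ∈ Ioo a b,
      l * w t ≤ c * ∫ s in a..t, mittagLeffler α (-μ * (t - s) ^ α) * g s) :
    ∀ t ∈ Icc a b, 0 ≤ w t := by
  have hwa : 0 ≤ w a := by
    have h1 : Tendsto (fun t => l * w t) (𝓝[>] a) (𝓝 (l * w a)) :=
      (((hwc a (left_mem_Icc.2 hab.le)).tendsto).mono_left
        (nhdsWithin_le_iff.2 (Icc_mem_nhdsGT hab))).const_mul l
    have h2 := (tendsto_integral_mittagLeffler_mul hα0 hα1 hμ hab hg).const_mul c
    have h3 := le_of_tendsto_of_tendsto h1 h2 (by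
      filter_upwards [Ioo_mem_nhdsGT hab] with t ht using h t ht)
    rw [mul_zero] at h3
    exact nonneg_of_mul_nonpos_right h3 hl
  have hIoo : ∀ t ∈ Ioo a b, 0 ≤ w t := by
    intro t ht
    by_contra! hneg
    -- Minimizing over `[a, t]` rather than `[a, b]` keeps `t₀ < b`, where the inequality is
    -- available; the endpoint `b` follows by continuity.
    obtain ⟨t₀, ht₀, hmin⟩ := isCompact_Icc.exists_isMinOn (nonempty_Icc.2 ht.1.le)
      (hwc.mono (Icc_subset_Icc_right ht.2.le))
    have hw₀ : w t₀ < 0 := (hmin (right_mem_Icc.2 ht.1.le)).trans_lt hneg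
    have hat₀ : a < t₀ := lt_of_le_of_ne ht₀.1 fun e => by rw [← e] at hw₀; linarith
    have ht₀b : t₀ < b := ht₀.2.trans_lt ht.2
    have hsub : Icc a t₀ ⊆ Icc a b := Icc_subset_Icc_right ht₀b.le
    have hint := integral_mul_nonpos_of_isMin hat₀.le
      (absolutelyContinuousOnInterval_mittagLeffler hα0 hα1 μ hat₀.le)
      (fun x hx y hy hxy => antitoneOn_mittagLeffler hα0 hα1 hμ (sub_nonneg.2 hy.2)
        (sub_nonneg.2 hx.2) (sub_le_sub_left hxy t₀))
      (mittagLeffler_nonneg hα0 hα1 hμ (sub_nonneg.2 hat₀.le))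
      (hg.mono_set (by rwa [uIcc_of_le hat₀.le, uIcc_of_le hab.le]))
      (fun s hs => hw s (hsub hs)) (fun s hs => hmin ⟨hs.1, hs.2.trans ht₀.2⟩)
    have h1 := h t₀ ⟨hat₀, ht₀b⟩
    have h2 := mul_pos_of_neg_of_neg hl hw₀
    have h3 := mul_nonpos_of_nonneg_of_nonpos hc.le hint
    linarith
  intro t ht
  have hcl : closure (Ioo a b) = Icc a b := closure_Ioo hab.ne
  exact le_on_closure (f := fun _ => 0) (g := w) (s := Ioo a b) hIoo continuousOn_const
    (by rwa [hcl]) (by rwa [hcl])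

/-- Comparison principle for the ABC derivative. -/
theorem le_of_abcDeriv_sub_le {B : ℝ → ℝ} (hB : 0 < B α) (hα0 : 0 < α) (hα1 : α < 1)
    (hab : a < b) {l : ℝ} (hl : l < 0) {u v : ℝ → ℝ}
    (huH : MemH1 a b u) (huC : ContinuousOn u (Icc a b))
    (hvH : MemH1 a b v) (hvC : ContinuousOn v (Icc a b))
    (h : ∀ t ∈ Ioo a b, l * (v t - u t) ≤ abcDeriv B α a b v t - abcDeriv B α a b u t) :
    ∀ t ∈ Icc a b, u t ≤ v t := by
  have hgu := huH.intervalIntegrable_weakDeriv hab.le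
  have hgv := hvH.intervalIntegrable_weakDeriv hab.le
  have hu := huH.hasWeakDeriv_weakDeriv.eq_add_integral hab hgu huC
  have hv := hvH.hasWeakDeriv_weakDeriv.eq_add_integral hab hgv hvC
  have h1α : 0 < 1 - α := sub_pos.2 hα1
  have hmain := nonneg_of_le_integral_mittagLeffler_mul (μ := α / (1 - α)) (c := B α / (1 - α))
    (w := fun t => v t - u t) (g := fun t => weakDeriv a b v t - weakDeriv a b u t)
    hα0 hα1 (by positivity) hab (by positivity) hl (hvC.sub huC) (hgv.sub hgu)
    (fun t ht => by
      have hsub : uIcc a t ⊆ uIcc a b := by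
        rw [uIcc_of_le ht.1, uIcc_of_le hab.le]
        exact Icc_subset_Icc_right ht.2
      rw [intervalIntegral.integral_sub (hgv.mono_set hsub) (hgu.mono_set hsub), hu t ht, hv t ht]
      ring)
    (fun t ht => by
      have ht' := Ioo_subset_Icc_self ht
      refine (h t ht).trans_eq ?_
      simp only [mul_sub]
      rw [intervalIntegral.integral_sub (intervalIntegrable_mittagLeffler_mul hα0 hα1 _ hgv ht')
        (intervalIntegrable_mittagLeffler_mul hα0 hα1 _ hgu ht'), mul_sub]
      rfl)
  exact fun t ht => sub_nonneg.1 (hmain t ht)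

end

theorem lemma4p2 (B : ℝ → ℝ) (hBpos : ∀ s ∈ Icc (0 : ℝ) 1, 0 < B s) (hB0 : B 0 = 1)
    (hB1 : B 1 = 1) (α : ℝ) (hα0 : 0 < α) (hα1 : α < 1) (a b : ℝ) (hab : a < b)
    (f : ℝ → ℝ → ℝ)
    (hf : ContDiffOn ℝ ∞ (fun p : ℝ × ℝ => f p.1 p.2) (Ioo a b ×ˢ (univ : Set ℝ)))
    (l₁ l₂ : ℝ) (hl₁ : l₁ < 0) (hl₂ : l₂ < 0) (h₁ h₂ : ℝ → ℝ)
    (u v₁ v₂ : ℝ → ℝ)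
    (huH : MemH1 a b u) (huC : ContinuousOn u (Icc a b))
    (hv₁H : MemH1 a b v₁) (hv₁C : ContinuousOn v₁ (Icc a b))
    (hv₂H : MemH1 a b v₂) (hv₂C : ContinuousOn v₂ (Icc a b))
    (hbound : ∀ t ∈ Ioo a b,
      l₂ * u t + h₂ t ≤ f t (u t) ∧ f t (u t) ≤ l₁ * u t + h₁ t)
    (hu : ∀ t ∈ Ioo a b, abcDeriv B α a b u t = f t (u t))
    (hv₁ : ∀ t ∈ Ioo a b, abcDeriv B α a b v₁ t = l₁ * v₁ t + h₁ t)
    (hv₂ : ∀ t ∈ Ioo a b, abcDeriv B α a b v₂ t = l₂ * v₂ t + h₂ t) :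
    ∀ t ∈ Icc a b, v₂ t ≤ u t ∧ u t ≤ v₁ t := by
  have hB := hBpos α ⟨hα0.le, hα1.le⟩
  intro t ht
  refine ⟨le_of_abcDeriv_sub_le hB hα0 hα1 hab hl₂ hv₂H hv₂C huH huC (fun s hs => ?_) t ht,
    le_of_abcDeriv_sub_le hB hα0 hα1 hab hl₁ huH huC hv₁H hv₁C (fun s hs => ?_) t ht⟩
  · rw [hu s hs, hv₂ s hs]
    linarith [(hbound s hs).1]
  · rw [hu s hs, hv₁ s hs]
    linarith [(hbound s hs).2]
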